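/- Let $r\ge 0$ and $q\ge r+1$ be integers. For integers $n\ge 1$ and $g\ge 0$ let $\mathcal{G}(n,g,r)$ be the set of all $r$-regular simple graphs on $n$ nodes with girth at least $g$, where the girth is the length of a shortest cycle, and is $\infty$ if there is no cycle. Let $Z(q,G)$ denote the number of proper colorings of the nodes of $G$ by $q$ colors. Then $$\lim_{g\to\infty}\ \sup_{n\ge 1}\ \sup_{G\in\mathcal{G}(n,g,r)}\left|\frac{\log Z(q,G)}{n}-\log\Big[q\Big(1-\frac1q\Big)^{r/2}\Big]\right|=0 ,$$ where the supremum over the empty set is $0$, and $0^0=1$ in the trivial case $r=0$, $q=1$. -/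

import Mathlib

open Filter Topology
open scoped ENNReal

/-- `𝒢(n, g, r)`: the `r`-regular simple graphs on `n` labelled nodes whose girth (length of a
shortest cycle, `∞` for a forest) is at least `g`. -/
def regularGraphs (n g r : ℕ) : Set (SimpleGraph (Fin n)) :=
  open Classical in {G | G.IsRegularOfDegree r ∧ (g : ℕ∞) ≤ G.egirth}

/-- `Z(q, G)`: the number of proper colorings of the nodes of `G` by `q` colors. -/
noncomputable def numColorings {n : ℕ} (q : ℕ) (G : SimpleGraph (Fin n)) : ℕ :=
  Nat.card (G.Coloring (Fin q))

/-! Write `q = b + 2`, so that degrees are at most `b + 1`. Deleting an edge `uv` of `G` leaves `H`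
with `Z(G) = Z(H) (1 - P)`, where `P` is the probability that a uniform colouring of `H` gives `u`
and `v` the same colour. If each such `P` is close to `1/q`, deleting all `nr/2` edges down to the
empty graph, which has `q^n` colourings, gives the formula, with an error per edge that depends only
on the girth (`abs_log_card_listColorings_sub_le`).

Large girth puts `v` outside a ball around `u` in `H` that induces a tree. Conditionally on the
colours outside this ball, the law of the colour of `u` is computed by the tree recursion `m c = K ∏
(1 - f z c)`, with at most `b` children at each node since `u` has lost an edge (`marginal_isMsg`).
It remains to see that this recursion forgets its boundary values.

This is a contraction over two rounds (`exists_log_ratio_contraction`). If the entries of each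
message differ by a factor at most `R`, then after one round any two values of `1 - m c` differ by a
factor at most `(1 + ρ (R - 1))^(1/b)`, with `ρ < 1` independent of `R`. The next round multiplies
at most `b` such factors, so `R` becomes `1 + ρ (R - 1)`. Iteration sends `R` to `1`
(`exists_ratio_bound`), and the messages become uniform whatever the boundary colouring. -/

/-! ### Elementary inequalities -/

/-- The function `log y + e^{1-y}` is increasing, in integrated form. -/
theorem exp_sub_exp_le_log_div {a b X : ℝ} (ha : 0 < a) (hab : a ≤ b) (hX : 0 ≤ X) :
    Real.exp (1 - a * X) - Real.exp (1 - b * X) ≤ Real.log (b / a) := by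
  have hb : 0 < b := ha.trans_le hab
  rcases hX.eq_or_lt with rfl | hX
  · simpa using Real.log_nonneg ((one_le_div ha).2 hab)
  have hmono : MonotoneOn (fun y : ℝ => Real.log y + Real.exp (1 - y)) (Set.Ioi 0) := by
    have hd : ∀ y ∈ Set.Ioi (0 : ℝ),
        HasDerivAt (fun y : ℝ => Real.log y + Real.exp (1 - y)) (y⁻¹ - Real.exp (1 - y)) y := by
      intro y hy
      have h := (Real.hasDerivAt_log (ne_of_gt hy)).add
        (((hasDerivAt_id y).const_sub 1).exp)
      exact h.congr_deriv (by simp [sub_eq_add_neg])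
    refine monotoneOn_of_deriv_nonneg (convex_Ioi 0)
      (fun y hy => (hd y hy).continuousAt.continuousWithinAt) ?_ ?_
    · intro y hy
      rw [interior_Ioi] at hy
      exact (hd y hy).differentiableAt.differentiableWithinAt
    · intro y hy
      rw [interior_Ioi] at hy
      rw [(hd y hy).deriv]
      have hy : 0 < y := hy
      have h1 : y ≤ Real.exp (y - 1) := by linarith [Real.add_one_le_exp (y - 1)]
      have h2 : Real.exp (1 - y) = (Real.exp (y - 1))⁻¹ := by
        rw [← Real.exp_neg]; congr 1; ring
      rw [h2, sub_nonneg]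
      gcongr
  have h := hmono (a := a * X) (b := b * X) (Set.mem_Ioi.2 (by positivity))
    (Set.mem_Ioi.2 (by positivity)) (by gcongr)
  simp only at h
  rw [Real.log_mul ha.ne' hX.ne', Real.log_mul hb.ne' hX.ne'] at h
  rw [Real.log_div hb.ne' ha.ne']
  linarith

theorem neg_log_one_sub_sub_le {l m u : ℝ} (hlm : l ≤ m) (hmu : m ≤ u) (hu : u < 1) :
    -Real.log (1 - m) - -Real.log (1 - l) ≤ (m - l) / (1 - u) := by
  have h1 : 0 < 1 - m := by linarith
  have h2 : 0 < 1 - l := by linarith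
  have h3 := Real.log_le_sub_one_of_pos (div_pos h2 h1)
  rw [Real.log_div h2.ne' h1.ne'] at h3
  have h4 : (1 - l) / (1 - m) - 1 = (m - l) / (1 - m) := by field_simp; ring
  have h5 : (m - l) / (1 - m) ≤ (m - l) / (1 - u) := by gcongr
  linarith

/-- The difference of the two sides rises on `[0, 3/8]` and falls on `[3/8, 1/2]`, so only the
endpoints matter; at `1/2` the claim is `log 2 ≤ 7/10`. -/
theorem neg_log_one_sub_le {x : ℝ} (hx0 : 0 ≤ x) (hx : x ≤ 1 / 2) :
    -Real.log (1 - x) ≤ x + 4 / 5 * x ^ 2 := by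
  have hd : ∀ y : ℝ, y < 1 → HasDerivAt (fun y : ℝ => y + 4 / 5 * y ^ 2 + Real.log (1 - y))
      (y * (3 / 5 - 8 / 5 * y) / (1 - y)) y := by
    intro y hy
    have hy' : 1 - y ≠ 0 := by linarith
    have h := ((hasDerivAt_id y).add (((hasDerivAt_id y).pow 2).const_mul (4 / 5))).add
      (((hasDerivAt_id y).const_sub 1).log hy')
    refine h.congr_deriv ?_
    simp
    field_simp
    ring
  have hc : ∀ s ⊆ Set.Iio (1 : ℝ),
      ContinuousOn (fun y : ℝ => y + 4 / 5 * y ^ 2 + Real.log (1 - y)) s :=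
    fun s hs y hy => (hd y (hs hy)).continuousAt.continuousWithinAt
  rcases le_total x (3 / 8) with h | h
  · have hm : MonotoneOn (fun y : ℝ => y + 4 / 5 * y ^ 2 + Real.log (1 - y)) (Set.Icc 0 (3 / 8)) := by
      refine monotoneOn_of_deriv_nonneg (convex_Icc _ _)
        (hc _ fun y hy => show y < 1 by linarith [hy.2]) ?_ ?_
      · intro y hy
        rw [interior_Icc] at hy
        exact (hd y (by linarith [hy.2])).differentiableAt.differentiableWithinAt
      · intro y hy
        rw [interior_Icc] at hy
        rw [(hd y (by linarith [hy.2])).deriv]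
        exact div_nonneg (mul_nonneg hy.1.le (by linarith [hy.2])) (by linarith [hy.2])
    have := hm (a := 0) (b := x) ⟨le_rfl, by norm_num⟩ ⟨hx0, h⟩ hx0
    simp at this
    linarith
  · have hm : AntitoneOn (fun y : ℝ => y + 4 / 5 * y ^ 2 + Real.log (1 - y))
        (Set.Icc (3 / 8) (1 / 2)) := by
      refine antitoneOn_of_deriv_nonpos (convex_Icc _ _)
        (hc _ fun y hy => show y < 1 by linarith [hy.2]) ?_ ?_
      · intro y hy
        rw [interior_Icc] at hy
        exact (hd y (by linarith [hy.2])).differentiableAt.differentiableWithinAt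
      · intro y hy
        rw [interior_Icc] at hy
        rw [(hd y (by linarith [hy.2])).deriv]
        refine div_nonpos_of_nonpos_of_nonneg ?_ (by linarith [hy.2])
        exact mul_nonpos_of_nonneg_of_nonpos (by linarith [hy.1]) (by linarith [hy.1])
    have := hm (a := x) (b := 1 / 2) ⟨h, hx⟩ ⟨by norm_num, le_rfl⟩ hx
    have h2 : Real.log (1 - 1 / 2) = -Real.log 2 := by
      rw [← Real.log_inv]; norm_num
    simp only [h2] at this
    have := Real.log_two_lt_d9
    norm_num at *
    linarith

theorem le_neg_log_one_sub {x : ℝ} (hx : x < 1) : x ≤ -Real.log (1 - x) := by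
  have := Real.log_le_sub_one_of_pos (x := 1 - x) (by linarith)
  linarith

/-- Both sides are compared with linear functions of `t`: a chord-type bound for the exponential,
and the tangent of `log` at `3/5`. It provides the room needed in the contraction when `R` exceeds
`q` substantially, with `t = q / R`. -/
theorem exp_le_exp_one_sub_log {t : ℝ} (ht0 : 0 < t) (ht : t ≤ 4 / 5) :
    Real.exp (7 / 5 - t / 2) ≤ Real.exp 1 - Real.log t - 1 / 10 := by
  obtain ⟨x, hx⟩ : ∃ x, x = 2 / 5 - t / 2 := ⟨_, rfl⟩
  have hx0 : 0 ≤ x := by linarith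
  have hx1 : x ≤ 2 / 5 := by linarith
  have h1 : Real.exp x ≤ 1 + 1.24 * x := by
    have h := Real.exp_bound' hx0 (by linarith) (n := 3) (by norm_num)
    norm_num [Finset.sum_range_succ, Nat.factorial] at h
    nlinarith [mul_nonneg hx0 (sub_nonneg.2 hx1),
      mul_nonneg (mul_nonneg hx0 hx0) (sub_nonneg.2 hx1)]
  have h2 : Real.exp (7 / 5 - t / 2) = Real.exp 1 * Real.exp x := by
    rw [← Real.exp_add]; congr 1; linarith
  have h3 : (1 : ℝ) / 2 ≤ Real.log (5 / 3) := by
    have h : Real.log ((5 / 3) ^ 2) = 2 * Real.log (5 / 3) := by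
      rw [Real.log_pow]; norm_num
    have h' : (1 : ℝ) ≤ Real.log ((5 / 3) ^ 2) := by
      rw [Real.le_log_iff_exp_le (by norm_num)]
      linarith [Real.exp_one_lt_d9]
    linarith
  have h4 : Real.log (5 / 3 * t) ≤ 5 / 3 * t - 1 := Real.log_le_sub_one_of_pos (by positivity)
  rw [Real.log_mul (by norm_num) ht0.ne'] at h4
  have h5 := Real.exp_one_lt_d9
  have h6 := Real.exp_one_gt_d9
  rw [h2]
  nlinarith [Real.exp_pos 1]

/-- `-log (1 - x)`. -/
noncomputable def negLogCompl (x : ℝ) : ℝ := -Real.log (1 - x)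

theorem one_sub_sum_le_prod_one_sub {ι : Type*} (s : Finset ι) (f : ι → ℝ)
    (h0 : ∀ i, 0 ≤ f i) (h1 : ∀ i, f i ≤ 1) : 1 - ∑ i ∈ s, f i ≤ ∏ i ∈ s, (1 - f i) := by
  classical
  induction s using Finset.induction_on with
  | empty => simp
  | insert a s ha ih =>
    rw [Finset.sum_insert ha, Finset.prod_insert ha]
    have hp : ∏ i ∈ s, (1 - f i) ≤ 1 :=
      Finset.prod_le_one (fun i _ => by linarith [h1 i]) (fun i _ => by linarith [h0 i])
    nlinarith [h0 a, h1 a]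

/-- Jensen's inequality for `exp` (equivalently AM-GM), by summing tangent-line bounds at the mean.
-/
theorem card_mul_exp_le_sum_exp {ι : Type*} (s : Finset ι) (a : ι → ℝ) {b : ℝ} (hb : 0 < b)
    (hs : (s.card : ℝ) = b) : b * Real.exp ((∑ k ∈ s, a k) / b) ≤ ∑ k ∈ s, Real.exp (a k) := by
  set c := (∑ k ∈ s, a k) / b with hc
  have h : ∀ k ∈ s, Real.exp c * (a k - c + 1) ≤ Real.exp (a k) := by
    intro k _
    have h1 := Real.add_one_le_exp (a k - c)
    calc Real.exp c * (a k - c + 1) ≤ Real.exp c * Real.exp (a k - c) := by gcongr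
      _ = Real.exp (a k) := by rw [← Real.exp_add]; congr 1; ring
  refine le_trans (le_of_eq ?_) (Finset.sum_le_sum h)
  rw [← Finset.mul_sum]
  simp only [Finset.sum_add_distrib, Finset.sum_sub_distrib, Finset.sum_const, nsmul_eq_mul, hs]
  have : ∑ k ∈ s, a k = b * c := by rw [hc]; field_simp
  rw [this]; ring

/-! ### Contraction of the tree recursion -/

/-- The odds of avoiding colour `j` against avoiding colour `i`, after one step of the tree
recursion. -/
theorem mul_log_ratio_le {α : Type*} [Fintype α] [DecidableEq α] {b d : ℕ} (hb : 0 < b)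
    (hα : Fintype.card α = b + 2) (hd : d ≤ b) (f : Fin d → α → ℝ) (hf : ∀ z c, f z c < 1)
    {θ C B : ℝ} (hC : 0 ≤ C) (hB0 : 0 ≤ B)
    (hB : ∀ D : ℝ, 0 ≤ D → Real.exp (C - θ * D / b) - Real.exp (C - θ * D / b - D) ≤ B)
    {i j : α} (hij : i ≠ j)
    (hz : ∀ z, ∑ k ∈ (Finset.univ.erase i).erase j, (negLogCompl (f z k) - negLogCompl (f z i))
      + θ * (negLogCompl (f z j) - negLogCompl (f z i)) ≤ C) :
    b * Real.log ((∑ k, ∏ z, (1 - f z k) - ∏ z, (1 - f z j)) /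
      (∑ k, ∏ z, (1 - f z k) - ∏ z, (1 - f z i))) ≤ B := by
  have hb' : (0 : ℝ) < b := by exact_mod_cast hb
  set s := (Finset.univ.erase i).erase j with hs
  have hji : j ∈ Finset.univ.erase i := Finset.mem_erase.2 ⟨hij.symm, Finset.mem_univ _⟩
  have hcard : s.card = b := by
    rw [hs, Finset.card_erase_of_mem hji, Finset.card_erase_of_mem (Finset.mem_univ _),
      Finset.card_univ, hα]
    omega
  set A : α → ℝ := fun k => ∏ z, (1 - f z k) with hA
  have hApos : ∀ k, 0 < A k := fun k => Finset.prod_pos fun z _ => by linarith [hf z k]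
  have hlogA : ∀ k, Real.log (A k) = -∑ z, negLogCompl (f z k) := by
    intro k
    simp only [hA, negLogCompl]
    rw [Real.log_prod fun z _ => by linarith [hf z k]]
    simp
  have hS : ∑ k, A k = A i + (A j + ∑ k ∈ s, A k) := by
    rw [hs, Finset.add_sum_erase _ _ hji, Finset.add_sum_erase _ _ (Finset.mem_univ i)]
  set T := ∑ k ∈ s, A k with hT
  have hT0 : 0 ≤ T := Finset.sum_nonneg fun k _ => (hApos k).le
  have e1 : ∑ k, A k - A j = A i + T := by rw [hS]; ring
  have e2 : ∑ k, A k - A i = A j + T := by rw [hS]; ring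
  change b * Real.log ((∑ k, A k - A j) / (∑ k, A k - A i)) ≤ B
  rw [e1, e2]
  have hden : 0 < A j + T := by linarith [hApos j]
  rcases le_total (A i) (A j) with hle | hle
  · have : Real.log ((A i + T) / (A j + T)) ≤ 0 := by
      refine Real.log_nonpos (div_nonneg (by linarith [hApos i]) hden.le) ?_
      rw [div_le_one hden]; linarith
    nlinarith
  set g := (∑ k ∈ s, Real.log (A k)) / b with hg
  set D := Real.log (A i) - Real.log (A j) with hD
  have hD0 : 0 ≤ D := sub_nonneg.2 (Real.log_le_log (hApos j) hle)
  have hTg : b * Real.exp g ≤ T := by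
    refine (card_mul_exp_le_sum_exp s (fun k => Real.log (A k)) hb' (by rw [hcard])).trans_eq ?_
    exact Finset.sum_congr rfl fun k _ => Real.exp_log (hApos k)
  -- Use `log x ≤ x - 1`, drop `A j` from the denominator, and bound the other colours below by `b`
  -- times their geometric mean `exp g`.
  have hlog : Real.log ((A i + T) / (A j + T)) ≤ (A i - A j) / (b * Real.exp g) := by
    have h1 := Real.log_le_sub_one_of_pos (x := (A i + T) / (A j + T))
      (div_pos (by linarith [hApos i]) hden)
    have h2 : (A i + T) / (A j + T) - 1 = (A i - A j) / (A j + T) := by field_simp; ring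
    have h3 : (A i - A j) / (A j + T) ≤ (A i - A j) / (b * Real.exp g) := by
      exact div_le_div_of_nonneg_left (by linarith) (by positivity) (by linarith [hApos j])
    linarith
  -- This is `hz` summed over the children and divided by `b`; as `d ≤ b` and `0 ≤ C`, the total is
  -- at most `C`.
  have hstep : Real.log (A i) - g + θ * D / b ≤ C := by
    have e : Real.log (A i) - g + θ * D / b
        = (∑ z, (∑ k ∈ s, (negLogCompl (f z k) - negLogCompl (f z i))
          + θ * (negLogCompl (f z j) - negLogCompl (f z i)))) / b := by
      rw [hg, hD, Finset.sum_add_distrib, Finset.sum_comm, ← Finset.mul_sum]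
      simp only [Finset.sum_sub_distrib, hlogA, Finset.sum_const, hcard, nsmul_eq_mul,
        Finset.sum_neg_distrib]
      field_simp
      ring
    rw [e, div_le_iff₀ hb']
    calc _ ≤ ∑ z : Fin d, C := Finset.sum_le_sum fun z _ => hz z
      _ = d * C := by simp
      _ ≤ b * C := by gcongr
      _ = C * b := mul_comm _ _
  calc b * Real.log ((A i + T) / (A j + T)) ≤ b * ((A i - A j) / (b * Real.exp g)) := by gcongr
    _ = (A i - A j) / Real.exp g := by field_simp
    _ = Real.exp (Real.log (A i) - g) * (1 - Real.exp (-D)) := by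
        rw [Real.exp_sub, Real.exp_log (hApos i), hD, neg_sub, Real.exp_sub,
          Real.exp_log (hApos i), Real.exp_log (hApos j)]
        have := (hApos i).ne'
        field_simp
    _ ≤ Real.exp (C - θ * D / b) * (1 - Real.exp (-D)) := by
        exact mul_le_mul_of_nonneg_right (Real.exp_le_exp.2 (by linarith))
          (sub_nonneg.2 (Real.exp_le_one_iff.2 (by linarith)))
    _ = Real.exp (C - θ * D / b) - Real.exp (C - θ * D / b - D) := by
        rw [mul_sub, mul_one, ← Real.exp_add, sub_eq_add_neg (C - θ * D / b) D]
    _ ≤ B := hB D hD0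

/-- Probability vectors with entries at most `1 / 2` whose entries differ by a factor of at
most `R`. -/
structure BoundedRatio {α : Type*} [Fintype α] (R : ℝ) (m : α → ℝ) : Prop where
  nonneg : ∀ c, 0 ≤ m c
  sum_eq : ∑ c, m c = 1
  le_half : ∀ c, m c ≤ 1 / 2
  ratio : ∀ c c', m c ≤ R * m c'

section
variable {α : Type*} [Fintype α] [DecidableEq α] {b : ℕ} {R : ℝ} {m : α → ℝ}

/-- With `l` and `u` the extreme entries, each increment of `-log (1 - x)` is at most `(m k - l) /
(1 - u)`, which reduces the claim to a linear one. The weight `θ` is chosen so that `u ≤ R * l`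
gives `θ (u - l) ≤ (b + 1) l`; the condition `R ≤ b + 2` makes `θ ≥ 1`, so that the worst case is `m
j = u`. -/
theorem BoundedRatio.sum_rest_le (hα : Fintype.card α = b + 2) (hm : BoundedRatio R m)
    (hR : 1 < R) (hRb : R ≤ b + 2) {i j : α} (hij : i ≠ j) :
    ∑ k ∈ (Finset.univ.erase i).erase j, (negLogCompl (m k) - negLogCompl (m i))
      + (b + 1) / (R - 1) * (negLogCompl (m j) - negLogCompl (m i)) ≤ 1 := by
  set θ : ℝ := (b + 1) / (R - 1) with hθ
  have hR1 : 0 < R - 1 := by linarith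
  have hθ1 : 1 ≤ θ := by rw [hθ, one_le_div hR1]; linarith
  set s := (Finset.univ.erase i).erase j with hs
  have hji : j ∈ Finset.univ.erase i := Finset.mem_erase.2 ⟨hij.symm, Finset.mem_univ _⟩
  have hcard : s.card = b := by
    rw [hs, Finset.card_erase_of_mem hji, Finset.card_erase_of_mem (Finset.mem_univ _),
      Finset.card_univ, hα]
    omega
  have hsum : m i + (m j + ∑ k ∈ s, m k) = 1 := by
    rw [hs, Finset.add_sum_erase _ _ hji, Finset.add_sum_erase _ _ (Finset.mem_univ i), hm.sum_eq]
  have : Nonempty α := ⟨i⟩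
  obtain ⟨cl, hl⟩ := Finite.exists_min m
  obtain ⟨cu, hu⟩ := Finite.exists_max m
  set l := m cl
  set u := m cu
  have hu2 : u ≤ 1 / 2 := hm.le_half cu
  have huR : u ≤ R * l := hm.ratio cu cl
  have hφ : ∀ k, negLogCompl (m k) - negLogCompl (m i) ≤ (m k - l) / (1 - u) := by
    intro k
    have h1 := neg_log_one_sub_sub_le (hl k) (hu k) (by linarith)
    have h2 : Real.log (1 - m i) ≤ Real.log (1 - l) :=
      Real.log_le_log (by linarith [hm.le_half i]) (by linarith [hl i])
    simp only [negLogCompl]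
    linarith
  have h1 : ∑ k ∈ s, (negLogCompl (m k) - negLogCompl (m i))
      ≤ (1 - m i - m j - b * l) / (1 - u) := by
    refine (Finset.sum_le_sum fun k _ => hφ k).trans_eq ?_
    rw [← Finset.sum_div, Finset.sum_sub_distrib, Finset.sum_const, hcard, nsmul_eq_mul]
    congr 1
    linarith
  have h2 := mul_le_mul_of_nonneg_left (hφ j) (zero_le_one.trans hθ1)
  have h3 : (1 - m i - m j - b * l) / (1 - u) + θ * ((m j - l) / (1 - u)) ≤ 1 := by
    rw [mul_div_assoc', ← add_div, div_le_one (by linarith)]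
    have h4 : θ * (u - l) ≤ (b + 1) * l := by
      have : u - l ≤ (R - 1) * l := by linarith
      calc θ * (u - l) ≤ θ * ((R - 1) * l) := by gcongr
        _ = (b + 1) * l := by rw [hθ]; field_simp
    have h5 : (θ - 1) * (m j - l) ≤ (θ - 1) * (u - l) := by
      have := hu j
      gcongr
    have h6 := hl i
    nlinarith
  linarith

/-- The quadratic bound on `-log (1 - x)` gives `1 + (4/5 - t) u`, where `u` is the largest entry
and `t = (b + 2) / R`. The maximum comes from the sign of `4/5 - t` together with `0 ≤ u ≤ 1/2`. -/
theorem BoundedRatio.sum_rest_le' (hα : Fintype.card α = b + 2) (hm : BoundedRatio R m)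
    (hR : b + 2 ≤ R) {i j : α} (hij : i ≠ j) :
    ∑ k ∈ (Finset.univ.erase i).erase j, (negLogCompl (m k) - negLogCompl (m i))
      + 1 * (negLogCompl (m j) - negLogCompl (m i)) ≤ max 1 (7 / 5 - (b + 2) / R / 2) := by
  have hR0 : 0 < R := by linarith [b.cast_nonneg (α := ℝ)]
  have hji : j ∈ Finset.univ.erase i := Finset.mem_erase.2 ⟨hij.symm, Finset.mem_univ _⟩
  have hcard : ((Finset.univ.erase i).card : ℝ) = b + 1 := by
    rw [Finset.card_erase_of_mem (Finset.mem_univ _), Finset.card_univ, hα]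
    push_cast [Nat.add_sub_cancel]
    ring
  have hsum : m i + ∑ k ∈ Finset.univ.erase i, m k = 1 := by
    rw [Finset.add_sum_erase _ _ (Finset.mem_univ i), hm.sum_eq]
  have : Nonempty α := ⟨i⟩
  obtain ⟨cu, hu⟩ := Finite.exists_max m
  set u := m cu
  have hu0 : 0 ≤ u := hm.nonneg cu
  have hu2 : u ≤ 1 / 2 := hm.le_half cu
  have huR : u ≤ R * m i := hm.ratio cu i
  rw [one_mul, add_comm, Finset.add_sum_erase _ (fun k => negLogCompl (m k) - negLogCompl (m i)) hji]
  have hφ : ∀ k, negLogCompl (m k) - negLogCompl (m i) ≤ m k * (1 + 4 / 5 * u) - m i := by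
    intro k
    have h1 := neg_log_one_sub_le (hm.nonneg k) (hm.le_half k)
    have h2 := le_neg_log_one_sub (x := m i) (by linarith [hm.le_half i])
    have h3 := mul_le_mul_of_nonneg_left (hu k) (hm.nonneg k)
    simp only [negLogCompl]
    nlinarith
  have h1 : ∑ k ∈ Finset.univ.erase i, (negLogCompl (m k) - negLogCompl (m i))
      ≤ (1 - m i) * (1 + 4 / 5 * u) - (b + 1) * m i := by
    refine (Finset.sum_le_sum fun k _ => hφ k).trans_eq ?_
    rw [Finset.sum_sub_distrib, ← Finset.sum_mul, Finset.sum_const, nsmul_eq_mul, hcard]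
    congr 2
    linarith
  have h2 : (b + 2) / R * u ≤ (b + 2) * m i := by
    rw [div_mul_eq_mul_div, div_le_iff₀ hR0]
    nlinarith [b.cast_nonneg (α := ℝ)]
  have h3 : (1 - m i) * (1 + 4 / 5 * u) - (b + 1) * m i ≤ 1 + (4 / 5 - (b + 2) / R) * u := by
    nlinarith [mul_nonneg hu0 (hm.nonneg i)]
  refine (h1.trans h3).trans ?_
  rcases le_total (4 / 5) ((b + 2) / R) with h | h
  · exact le_max_of_le_left (by nlinarith)
  · exact le_max_of_le_right (by nlinarith)
end

theorem exists_log_ratio_contraction {α : Type*} [Fintype α] [DecidableEq α] {b : ℕ} (hb : 0 < b)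
    (hα : Fintype.card α = b + 2) : ∃ ρ : ℝ, 0 < ρ ∧ ρ < 1 ∧ ∀ R : ℝ, 1 < R → ∀ d ≤ b,
      ∀ f : Fin d → α → ℝ, (∀ z, BoundedRatio R (f z)) → ∀ i j : α, i ≠ j →
      b * Real.log ((∑ k, ∏ z, (1 - f z k) - ∏ z, (1 - f z j)) /
        (∑ k, ∏ z, (1 - f z k) - ∏ z, (1 - f z i))) ≤ Real.log (1 + ρ * (R - 1)) := by
  have hb' : (0 : ℝ) < b := by exact_mod_cast hb
  set L := Real.log (b + 2) with hL
  -- `δ` is the saving on `log R` when `R ≥ b + 2`. The first term serves `t ≥ 4/5`. The second is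
  -- at most the saving `L / (10 e)` that arises for `t ≤ 4/5` and `L ≤ e`, because `L ≥ 1/2`.
  set δ := min (L - Real.log (b + 1)) (1 / 60) with hδ
  have hδ1 : 0 < L - Real.log (b + 1) :=
    sub_pos.2 (Real.log_lt_log (by positivity) (by linarith))
  have hδ0 : 0 < δ := lt_min hδ1 (by norm_num)
  refine ⟨max (b / (b + 1)) (Real.exp (-δ)), lt_max_of_lt_right (Real.exp_pos _),
    max_lt ((div_lt_one (by positivity)).2 (by linarith)) ((Real.exp_lt_exp.2 (by linarith : -δ < 0)).trans_eq Real.exp_zero), ?_⟩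
  intro R hR d hd f hf i j hij
  set ρ : ℝ := max (b / (b + 1)) (Real.exp (-δ)) with hρ
  have hf1 : ∀ z c, f z c < 1 := fun z c => by linarith [(hf z).le_half c]
  rcases le_total R (b + 2) with hRb | hRb
  · have hR1 : 0 < R - 1 := by linarith
    refine (mul_log_ratio_le hb hα hd f hf1 (θ := (b + 1) / (R - 1)) (C := 1)
      (B := Real.log ((R + 1 / b) / (1 + 1 / b))) zero_le_one
      (Real.log_nonneg ((one_le_div (by positivity)).2 (by linarith))) ?_ hij
      fun z => (hf z).sum_rest_le hα hR hRb hij).trans ?_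
    · intro D hD
      -- Here `a * X` is `θ * D / b`, and the two exponents differ by exactly `D`.
      convert exp_sub_exp_le_log_div (a := 1 + 1 / b) (b := R + 1 / b) (X := D / (R - 1))
        (by positivity) (by linarith) (by positivity) using 3
      · field_simp
      · field_simp
        ring
    · refine Real.log_le_log (by positivity) ?_
      have h1 : (R + 1 / b) / (1 + 1 / b) = 1 + b / (b + 1) * (R - 1) := by field_simp; ring
      rw [h1]
      have := le_max_left ((b : ℝ) / (b + 1)) (Real.exp (-δ))
      gcongr
  · have hR0 : 0 < R := by linarith
    set t : ℝ := (b + 2) / R with ht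
    have ht0 : 0 < t := by positivity
    have ht1 : t ≤ 1 := (div_le_one hR0).2 hRb
    have hlogR : Real.log R = L - Real.log t := by
      rw [ht, Real.log_div (by positivity) hR0.ne']; ring
    have hlogt : Real.log t ≤ 0 := Real.log_nonpos ht0.le ht1
    have hb1 : 0 ≤ Real.log (b + 1) := Real.log_nonneg (by linarith)
    set C : ℝ := max 1 (7 / 5 - t / 2) with hC
    have hB : ∀ D : ℝ, 0 ≤ D → Real.exp (C - 1 * D / b) - Real.exp (C - 1 * D / b - D)
        ≤ min (Real.exp C) (Real.exp (C - 1) * Real.log (b + 1)) := by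
      intro D hD
      refine le_min ?_ ?_
      · have h1 : Real.exp (C - 1 * D / b) ≤ Real.exp C :=
          Real.exp_le_exp.2 (sub_le_self _ (by positivity))
        linarith [Real.exp_pos (C - 1 * D / b - D)]
      · have h := exp_sub_exp_le_log_div (a := 1 / b) (b := 1 + 1 / b) (X := D)
          (by positivity) (by linarith) hD
        have e : (1 + 1 / (b : ℝ)) / (1 / b) = b + 1 := by field_simp
        rw [e] at h
        calc _ = Real.exp (C - 1) * (Real.exp (1 - 1 / b * D)
              - Real.exp (1 - (1 + 1 / b) * D)) := by
              rw [mul_sub, ← Real.exp_add, ← Real.exp_add]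
              congr 2 <;> ring
          _ ≤ _ := by gcongr
    have hB0 : 0 ≤ min (Real.exp C) (Real.exp (C - 1) * Real.log (b + 1)) :=
      le_min (Real.exp_pos _).le (mul_nonneg (Real.exp_pos _).le hb1)
    have key := mul_log_ratio_le hb hα hd f hf1 (θ := 1) (C := C)
      (zero_le_one.trans (le_max_left _ _)) hB0 hB hij fun z => (hf z).sum_rest_le' hα hRb hij
    -- For `t ≥ 4/5` one has `C = 1` and the second bound suffices. For smaller `t`, the first bound
    -- is used when `L ≥ e` and the second when `L ≤ e`.
    have hgap : min (Real.exp C) (Real.exp (C - 1) * Real.log (b + 1)) ≤ Real.log R - δ := by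
      rw [hlogR]
      have hδa : δ ≤ L - Real.log (b + 1) := min_le_left _ _
      have hδb : δ ≤ 1 / 60 := min_le_right _ _
      rcases le_total (4 / 5) t with h | h
      · have hC1 : C = 1 := max_eq_left (by linarith)
        refine (min_le_right _ _).trans ?_
        rw [hC1]
        simp only [sub_self, Real.exp_zero]
        linarith
      · have hC1 : C = 7 / 5 - t / 2 := max_eq_right (by linarith)
        have hE := exp_le_exp_one_sub_log ht0 h
        rw [← hC1] at hE
        have he := Real.exp_one_lt_d9
        have he' := Real.exp_pos 1
        rcases le_total (Real.exp 1) L with h2 | h2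
        · exact (min_le_left _ _).trans (by linarith)
        · refine (min_le_right _ _).trans ?_
          have hL2 : 1 / 2 ≤ L := by
            have h3 := Real.log_two_gt_d9
            have h4 : Real.log 2 ≤ L := Real.log_le_log (by norm_num) (by linarith)
            linarith
          rw [Real.exp_sub, div_mul_eq_mul_div, div_le_iff₀ he']
          have h5 : Real.exp C * Real.log (b + 1)
              ≤ (Real.exp 1 - Real.log t - 1 / 10) * L :=
            mul_le_mul hE (by linarith) hb1 ((Real.exp_pos C).le.trans hE)
          nlinarith
    have h6 : Real.log R - δ ≤ Real.log (1 + ρ * (R - 1)) := by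
      rw [Real.le_log_iff_exp_le (by have : 0 < ρ := lt_max_of_lt_right (Real.exp_pos _); nlinarith),
        sub_eq_neg_add, Real.exp_add, Real.exp_log hR0]
      have h7 : Real.exp (-δ) ≤ ρ := le_max_right _ _
      have h8 : Real.exp (-δ) ≤ 1 := Real.exp_le_one_iff.2 (by linarith)
      nlinarith
    exact key.trans (hgap.trans h6)

/-! ### Messages and their convergence to uniform -/

/-- `IsMsg b n m`: the vector `m` is obtained by `n` rounds of the tree recursion for proper
colourings, with at most `b` children at each node, from arbitrary probability vectors. -/
def IsMsg {α : Type*} [Fintype α] (b : ℕ) : ℕ → (α → ℝ) → Prop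
  | 0, m => (∀ c, 0 ≤ m c) ∧ ∑ c, m c = 1
  | n + 1, m => ∃ d ≤ b, ∃ f : Fin d → α → ℝ, (∀ z, IsMsg b n (f z)) ∧
      ∃ K : ℝ, 0 ≤ K ∧ (∀ c, m c = K * ∏ z, (1 - f z c)) ∧ ∑ c, m c = 1

section
variable {α : Type*} [Fintype α] {b : ℕ}

theorem IsMsg.sum_eq {n : ℕ} {m : α → ℝ} (h : IsMsg b n m) : ∑ c, m c = 1 := by
  cases n with
  | zero => exact h.2
  | succ n => obtain ⟨_, _, _, _, _, _, _, h⟩ := h; exact h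

theorem IsMsg.mem_Icc {n : ℕ} : ∀ {m : α → ℝ}, IsMsg b n m → ∀ c, 0 ≤ m c ∧ m c ≤ 1 := by
  have aux : ∀ {m : α → ℝ}, (∀ c, 0 ≤ m c) → ∑ c, m c = 1 → ∀ c, 0 ≤ m c ∧ m c ≤ 1 :=
    fun h0 h1 c => ⟨h0 c, h1 ▸ Finset.single_le_sum (fun i _ => h0 i) (Finset.mem_univ c)⟩
  induction n with
  | zero => exact fun h => aux h.1 h.2
  | succ n ih =>
    rintro m ⟨d, _, f, hf, K, hK, hm, hs⟩
    refine aux (fun c => ?_) hs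
    rw [hm]
    exact mul_nonneg hK (Finset.prod_nonneg fun z _ => by linarith [(ih (hf z) c).2])

/-- A union bound over the children makes the unnormalised weights sum to at least `(b + 2) - d ≥
2`, while each is at most `1`. -/
theorem IsMsg.le_half (hα : Fintype.card α = b + 2) {n : ℕ} {m : α → ℝ} (h : IsMsg b (n + 1) m)
    (c : α) : m c ≤ 1 / 2 := by
  obtain ⟨d, hd, f, hf, K, hK, hm, hs⟩ := h
  have hd' : (d : ℝ) ≤ b := by exact_mod_cast hd
  have h2 : (2 : ℝ) ≤ ∑ c, ∏ z, (1 - f z c) := by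
    calc (2 : ℝ) ≤ ∑ c : α, (1 - ∑ z, f z c) := by
          rw [Finset.sum_sub_distrib, Finset.sum_comm]
          simp only [fun z => (hf z).sum_eq]
          simp [hα]
          linarith
      _ ≤ _ := Finset.sum_le_sum fun c _ => one_sub_sum_le_prod_one_sub _ _
          (fun z => ((hf z).mem_Icc c).1) (fun z => ((hf z).mem_Icc c).2)
  have h3 : K * 2 ≤ 1 := by
    rw [← hs]
    simp only [hm]
    rw [← Finset.mul_sum]
    gcongr
  have h4 : ∏ z, (1 - f z c) ≤ 1 := Finset.prod_le_one
    (fun z _ => by linarith [((hf z).mem_Icc c).2]) (fun z _ => by linarith [((hf z).mem_Icc c).1])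
  rw [hm]
  nlinarith

theorem IsMsg.ratio_le_two_pow (hα : Fintype.card α = b + 2) {n : ℕ} {m : α → ℝ}
    (h : IsMsg b (n + 2) m) (c c' : α) : m c ≤ 2 ^ b * m c' := by
  obtain ⟨d, hd, f, hf, K, hK, hm, hs⟩ := h
  have h4 : ∏ z, (1 - f z c) ≤ 1 := Finset.prod_le_one
    (fun z _ => by linarith [((hf z).mem_Icc c).2]) (fun z _ => by linarith [((hf z).mem_Icc c).1])
  have h5 : (1 / 2 : ℝ) ^ b ≤ ∏ z, (1 - f z c') := by
    calc (1 / 2 : ℝ) ^ b ≤ (1 / 2) ^ d := pow_le_pow_of_le_one (by norm_num) (by norm_num) hd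
      _ = ∏ z : Fin d, (1 / 2 : ℝ) := by simp
      _ ≤ _ := Finset.prod_le_prod (fun _ _ => by norm_num)
          fun z _ => by linarith [(hf z).le_half hα c']
  have h6 : (2 : ℝ) ^ b * (1 / 2) ^ b = 1 := by rw [← mul_pow]; norm_num
  have h7 := mul_le_mul_of_nonneg_left h5 (by positivity : (0 : ℝ) ≤ 2 ^ b)
  rw [hm, hm]
  nlinarith

/-- The normalisation `K * S = 1` turns the ratio in `hρ` into `(1 - m j) / (1 - m i)`. The division
by `b` in the exponent prepares for the product over at most `b` children. -/
theorem IsMsg.one_sub_le [DecidableEq α] {ρ R : ℝ} (hb : 0 < b) (hα : Fintype.card α = b + 2)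
    (hρ : ∀ d ≤ b, ∀ f : Fin d → α → ℝ, (∀ z, BoundedRatio R (f z)) → ∀ i j : α, i ≠ j →
      b * Real.log ((∑ k, ∏ z, (1 - f z k) - ∏ z, (1 - f z j)) /
        (∑ k, ∏ z, (1 - f z k) - ∏ z, (1 - f z i))) ≤ Real.log (1 + ρ * (R - 1)))
    {n : ℕ} (hn : ∀ m : α → ℝ, IsMsg b n m → BoundedRatio R m) {m : α → ℝ}
    (h : IsMsg b (n + 1) m) {i j : α} (hij : i ≠ j) :
    1 - m j ≤ Real.exp (Real.log (1 + ρ * (R - 1)) / b) * (1 - m i) := by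
  have hb' : (0 : ℝ) < b := by exact_mod_cast hb
  have hhalf := h.le_half hα
  obtain ⟨d, hd, f, hf, K, hK, hm, hs⟩ := h
  have h1 := hρ d hd f (fun z => hn _ (hf z)) i j hij
  set S := ∑ k, ∏ z, (1 - f z k) with hS
  have hKS : K * S = 1 := by
    rw [← hs, hS, Finset.mul_sum]; simp only [hm]
  have hK0 : K ≠ 0 := left_ne_zero_of_mul_eq_one hKS
  have e : ∀ c, 1 - m c = K * (S - ∏ z, (1 - f z c)) := by
    intro c; rw [mul_sub, hKS, hm]
  have e2 : (S - ∏ z, (1 - f z j)) / (S - ∏ z, (1 - f z i)) = (1 - m j) / (1 - m i) := by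
    rw [e, e, mul_div_mul_left _ _ hK0]
  have hi : 0 < 1 - m i := by linarith [hhalf i]
  have hj : 0 < 1 - m j := by linarith [hhalf j]
  rw [e2] at h1
  rw [← div_le_iff₀ hi, ← Real.log_le_iff_le_exp (div_pos hj hi), le_div_iff₀ hb']
  linarith

theorem exists_ratio_bound (hα : Fintype.card α = b + 2) : ∃ R : ℕ → ℝ, Tendsto R atTop (𝓝 1) ∧
    (∀ n, 1 ≤ R n) ∧ ∀ n (m : α → ℝ), IsMsg b (n + 2) m → BoundedRatio (R n) m := by
  classical
  rcases Nat.eq_zero_or_pos b with rfl | hb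
  · refine ⟨fun _ => 1, tendsto_const_nhds, fun _ => le_rfl, fun n m h =>
      ⟨fun c => (h.mem_Icc c).1, h.sum_eq, h.le_half hα, fun c c' => ?_⟩⟩
    obtain ⟨d, hd, f, hf, K, hK, hm, hs⟩ := h
    obtain rfl : d = 0 := by omega
    simp [hm]
  obtain ⟨ρ, hρ0, hρ1, hρ⟩ := exists_log_ratio_contraction hb hα
  -- The exponent is `n / 2` because one contraction takes two rounds; `2 ^ b` is the crude ratio
  -- bound that starts both parities.
  set R : ℕ → ℝ := fun n => 1 + 2 ^ b * ρ ^ (n / 2) with hR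
  have hR1 : ∀ n, 1 < R n := fun n => by
    have : 0 < 2 ^ b * ρ ^ (n / 2) := by positivity
    simp only [hR]; linarith
  have hstep : ∀ n, R (n + 2) = 1 + ρ * (R n - 1) := by
    intro n
    have : (n + 2) / 2 = n / 2 + 1 := by omega
    simp only [hR, this, pow_succ]
    ring
  have hbase : ∀ n, n < 2 → ∀ m : α → ℝ, IsMsg b (n + 2) m → BoundedRatio (R n) m := by
    intro n hn m h
    refine ⟨fun c => (h.mem_Icc c).1, h.sum_eq, h.le_half hα, fun c c' => ?_⟩
    refine (h.ratio_le_two_pow hα c c').trans ?_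
    have : n / 2 = 0 := by omega
    have h0 := (h.mem_Icc c').1
    simp only [hR, this, pow_zero]
    nlinarith
  refine ⟨R, ?_, fun n => (hR1 n).le, fun n => ?_⟩
  · have h1 : Tendsto (fun n : ℕ => n / 2) atTop atTop :=
      Nat.tendsto_div_const_atTop (by norm_num)
    have h2 := ((tendsto_pow_atTop_nhds_zero_of_lt_one hρ0.le hρ1).comp h1).const_mul (2 ^ b : ℝ)
    simpa using h2.const_add 1
  · induction n using Nat.twoStepInduction with
    | zero => exact hbase 0 (by norm_num)
    | one => exact hbase 1 (by norm_num)
    | more n ih _ =>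
      intro m h
      refine ⟨fun c => (h.mem_Icc c).1, h.sum_eq, h.le_half hα, fun c c' => ?_⟩
      have hR' : 1 < 1 + ρ * (R n - 1) := by nlinarith [hR1 n]
      rw [hstep]
      rcases eq_or_ne c' c with rfl | hc
      · nlinarith [(h.mem_Icc c').1]
      obtain ⟨d, hd, f, hf, K, hK, hm, hs⟩ := h
      have hf1 : ∀ z c, 0 ≤ 1 - f z c := fun z c => by linarith [((hf z).mem_Icc c).2]
      have h1 : ∏ z, (1 - f z c) ≤ (1 + ρ * (R n - 1)) * ∏ z, (1 - f z c') := by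
        calc ∏ z, (1 - f z c)
            ≤ ∏ z, (Real.exp (Real.log (1 + ρ * (R n - 1)) / b) * (1 - f z c')) :=
              Finset.prod_le_prod (fun z _ => hf1 z c) fun z _ =>
                (hf z).one_sub_le hb hα (hρ (R n) (hR1 n)) ih hc
          _ = Real.exp (Real.log (1 + ρ * (R n - 1)) / b) ^ d * ∏ z, (1 - f z c') := by
              rw [Finset.prod_mul_distrib]; simp
          _ ≤ Real.exp (Real.log (1 + ρ * (R n - 1)) / b) ^ b * ∏ z, (1 - f z c') := by
              gcongr
              · exact Finset.prod_nonneg fun z _ => hf1 z c'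
              · exact Real.one_le_exp (div_nonneg (Real.log_nonneg hR'.le) (by positivity))
          _ = (1 + ρ * (R n - 1)) * ∏ z, (1 - f z c') := by
              have hb' : (b : ℝ) ≠ 0 := by exact_mod_cast hb.ne'
              rw [← Real.exp_nat_mul, mul_div_cancel₀ _ hb', Real.exp_log (by linarith)]
      rw [hm, hm]
      nlinarith
end

/-! ### List colourings and the tree recursion for their marginals -/

open Classical in
theorem sum_card_filter_eq {V α : Type*} [Fintype α] (s : Finset (V → α)) (u : V) :
    ∑ c, (s.filter fun σ => σ u = c).card = s.card :=
  (Finset.card_eq_sum_card_fiberwise (f := fun σ : V → α => σ u) (t := Finset.univ)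
    fun _ _ => Finset.mem_coe.2 (Finset.mem_univ _)).symm

section
variable {V α : Type*} [Fintype V] [Fintype α]

open Classical in
/-- The proper colourings of `G` taking the colour of each node `x` from the list `L x`. -/
noncomputable def listColorings (G : SimpleGraph V) (L : V → Set α) : Finset (V → α) :=
  Finset.univ.filter fun σ => (∀ x y, G.Adj x y → σ x ≠ σ y) ∧ ∀ x, σ x ∈ L x

theorem mem_listColorings {G : SimpleGraph V} {L : V → Set α} {σ : V → α} :
    σ ∈ listColorings G L ↔ (∀ x y, G.Adj x y → σ x ≠ σ y) ∧ ∀ x, σ x ∈ L x := by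
  simp [listColorings]

theorem listColorings_anti {G G' : SimpleGraph V} (h : G' ≤ G) (L : V → Set α) :
    listColorings G L ⊆ listColorings G' L := fun σ hσ => by
  rw [mem_listColorings] at hσ ⊢
  exact ⟨fun x y hxy => hσ.1 x y (h hxy), hσ.2⟩

open Classical in
theorem mix_mem_listColorings {G : SimpleGraph V} {L : V → Set α} (u : V) {σ τ : V → α}
    (hσ : σ ∈ listColorings G L) (hτ : τ ∈ listColorings G L) :
    (fun x => if G.Reachable u x then σ x else τ x) ∈ listColorings G L := by
  rw [mem_listColorings] at *
  refine ⟨fun x y hxy => ?_, fun x => ?_⟩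
  · have : G.Reachable u x ↔ G.Reachable u y :=
      ⟨fun h => h.trans hxy.reachable, fun h => h.trans hxy.symm.reachable⟩
    by_cases h : G.Reachable u y
    · simpa [h, this] using hσ.1 x y hxy
    · simpa [h, this] using hτ.1 x y hxy
  · by_cases h : G.Reachable u x
    · simpa [h] using hσ.2 x
    · simpa [h] using hτ.2 x

open Classical in
/-- The colours of two nodes in different components are independent. -/
theorem card_listColorings_and_mul {G : SimpleGraph V} {L : V → Set α} {u w : V}
    (huw : ¬ G.Reachable u w) (c c' : α) :
    ((listColorings G L).filter fun σ => σ u = c ∧ σ w = c').card * (listColorings G L).card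
      = ((listColorings G L).filter fun σ => σ u = c).card
        * ((listColorings G L).filter fun σ => σ w = c').card := by
  rw [← Finset.card_product, ← Finset.card_product]
  have hu : G.Reachable u u := .rfl
  -- Exchanging two colourings outside the component of `u` is an involution on pairs; it moves the
  -- constraint at `w` from one colouring to the other.
  refine Finset.card_nbij'
    (fun p => (fun x => if G.Reachable u x then p.1 x else p.2 x,
      fun x => if G.Reachable u x then p.2 x else p.1 x))
    (fun p => (fun x => if G.Reachable u x then p.1 x else p.2 x,
      fun x => if G.Reachable u x then p.2 x else p.1 x)) ?_ ?_ ?_ ?_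
  · rintro ⟨σ, τ⟩ h
    simp only [Finset.coe_product, Set.mem_prod, Finset.mem_coe, Finset.mem_filter] at h ⊢
    obtain ⟨⟨hσ, h1, h2⟩, hτ⟩ := h
    exact ⟨⟨mix_mem_listColorings u hσ hτ, by simpa [hu] using h1⟩,
      mix_mem_listColorings u hτ hσ, by simpa [huw] using h2⟩
  · rintro ⟨σ, τ⟩ h
    simp only [Finset.coe_product, Set.mem_prod, Finset.mem_coe, Finset.mem_filter] at h ⊢
    obtain ⟨⟨hσ, h1⟩, hτ, h2⟩ := h
    exact ⟨⟨mix_mem_listColorings u hσ hτ, by simpa [hu] using h1, by simpa [huw] using h2⟩,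
      mix_mem_listColorings u hτ hσ⟩
  · rintro ⟨σ, τ⟩ _
    ext x <;> by_cases h : G.Reachable u x <;> simp [h]
  · rintro ⟨σ, τ⟩ _
    ext x <;> by_cases h : G.Reachable u x <;> simp [h]

open Classical in
/-- The fraction of list colourings that give the node `u` the colour `c`. -/
noncomputable def marginal (G : SimpleGraph V) (L : V → Set α) (u : V) (c : α) : ℝ :=
  ((listColorings G L).filter fun σ => σ u = c).card / (listColorings G L).card

theorem sum_marginal {G : SimpleGraph V} {L : V → Set α} (h : (listColorings G L).Nonempty)
    (u : V) : ∑ c, marginal G L u c = 1 := by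
  classical
  simp only [marginal]
  rw [← Finset.sum_div, ← Nat.cast_sum, sum_card_filter_eq]
  exact div_self (by exact_mod_cast h.card_pos.ne')

open Classical in
theorem card_filter_eq_of_isolated {G : SimpleGraph V} {L : V → Set α} {u : V}
    (hu : ∀ x, ¬ G.Adj u x) (hL : L u = Set.univ) (c c' : α) :
    ((listColorings G L).filter fun σ => σ u = c).card
      = ((listColorings G L).filter fun σ => σ u = c').card := by
  have key : ∀ (c c' : α) (σ : V → α), σ ∈ (listColorings G L).filter (fun σ => σ u = c) →
      Function.update σ u c' ∈ (listColorings G L).filter (fun σ => σ u = c') := by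
    intro c c' σ hσ
    simp only [Finset.mem_filter, mem_listColorings] at hσ ⊢
    refine ⟨⟨fun x y hxy => ?_, fun x => ?_⟩, by simp⟩
    · have hx : x ≠ u := by rintro rfl; exact hu _ hxy
      have hy : y ≠ u := by rintro rfl; exact hu _ hxy.symm
      simpa [hx, hy] using hσ.1.1 x y hxy
    · by_cases hx : x = u
      · subst hx; simp [hL]
      · simpa [hx] using hσ.1.2 x
  refine Finset.card_nbij' (fun σ => Function.update σ u c') (fun σ => Function.update σ u c)
    (fun σ hσ => key c c' σ hσ) (fun σ hσ => key c' c σ hσ) ?_ ?_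
  · intro σ hσ
    have : σ u = c := (Finset.mem_filter.1 hσ).2
    simp [← this]
  · intro σ hσ
    have : σ u = c' := (Finset.mem_filter.1 hσ).2
    simp [← this]

open Classical in
/-- Inserting an edge between two components. -/
theorem card_filter_eq_of_isBridge {G : SimpleGraph V} {L : V → Set α} {u w : V}
    (hbr : G.IsBridge s(u, w)) (huw : G.Adj u w)
    (hne : (listColorings (G.deleteEdges {s(u, w)}) L).Nonempty) (c : α) :
    (((listColorings G L).filter fun σ => σ u = c).card : ℝ)
      = ((listColorings (G.deleteEdges {s(u, w)}) L).filter fun σ => σ u = c).card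
        * (1 - marginal (G.deleteEdges {s(u, w)}) L w c) := by
  set G' := G.deleteEdges {s(u, w)} with hG'
  have h1 : (listColorings G L).filter (fun σ => σ u = c)
      = ((listColorings G' L).filter fun σ => σ u = c).filter fun σ => ¬ σ w = c := by
    ext σ
    simp only [Finset.mem_filter, mem_listColorings, hG', SimpleGraph.deleteEdges_adj,
      Set.mem_singleton_iff]
    constructor
    · rintro ⟨⟨h, hL⟩, hc⟩
      exact ⟨⟨⟨fun x y hxy => h x y hxy.1, hL⟩, hc⟩, fun h' => h u w huw (hc.trans h'.symm)⟩
    · rintro ⟨⟨⟨h, hL⟩, hc⟩, hw⟩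
      refine ⟨⟨fun x y hxy => ?_, hL⟩, hc⟩
      by_cases he : s(x, y) = s(u, w)
      · rcases Sym2.eq_iff.1 he with ⟨rfl, rfl⟩ | ⟨rfl, rfl⟩
        · rw [hc]; exact fun h' => hw h'.symm
        · rw [hc]; exact hw
      · exact h x y ⟨hxy, he⟩
  have h2 := Finset.card_filter_add_card_filter_not (s := (listColorings G' L).filter
    fun σ => σ u = c) (fun σ => σ w = c)
  rw [← h1, Finset.filter_filter] at h2
  have h3 := card_listColorings_and_mul (G := G') (L := L) (SimpleGraph.isBridge_iff.1 hbr) c c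
  have h4 : ((listColorings G' L).card : ℝ) ≠ 0 := by exact_mod_cast hne.card_pos.ne'
  have h2' := congrArg (Nat.cast (R := ℝ)) h2
  have h3' := congrArg (Nat.cast (R := ℝ)) h3
  push_cast at h2' h3'
  rw [marginal]
  field_simp
  linear_combination ((listColorings G' L).card : ℝ) * h2' - h3'

variable {b : ℕ}

open Classical in
/-- One round of the tree recursion. -/
theorem exists_msg_of_isAcyclic {n : ℕ}
    (IH : ∀ (G : SimpleGraph V) (L : V → Set α) (u : V), G.IsAcyclic →
      (∀ x, (G.neighborSet x).ncard ≤ b + 1) → (G.neighborSet u).ncard ≤ b →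
      (∀ x (p : G.Walk u x), p.length < n → L x = Set.univ) → (listColorings G L).Nonempty →
      IsMsg b n (marginal G L u))
    (L : V → Set α) (u : V) (d : ℕ) : ∀ G : SimpleGraph V, G.IsAcyclic →
      (∀ x, (G.neighborSet x).ncard ≤ b + 1) → (G.neighborSet u).ncard = d →
      (∀ x (p : G.Walk u x), p.length < n + 1 → L x = Set.univ) → (listColorings G L).Nonempty →
      ∃ f : Fin d → α → ℝ, (∀ z, IsMsg b n (f z)) ∧ ∃ K : ℝ, 0 ≤ K ∧ ∀ c,
        (((listColorings G L).filter fun σ => σ u = c).card : ℝ) = K * ∏ z, (1 - f z c) := by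
  induction d with
  | zero =>
    intro G _ _ hd hL hne
    obtain ⟨σ₀, _⟩ := hne
    refine ⟨fun z => z.elim0, fun z => z.elim0,
      ((listColorings G L).filter fun σ => σ u = σ₀ u).card, by positivity, fun c => ?_⟩
    rw [Set.ncard_eq_zero] at hd
    have hu : ∀ x, ¬ G.Adj u x := fun x hx => by
      have : x ∈ G.neighborSet u := hx
      simp [hd] at this
    -- The empty walk shows that the list at `u` is full, so all colours of the isolated node `u`
    -- are equally frequent.
    simp [card_filter_eq_of_isolated hu (hL u .nil (by simp)) c (σ₀ u)]
  | succ d ih =>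
    intro G hG hdeg hd hL hne
    obtain ⟨w, hw⟩ : (G.neighborSet u).Nonempty := by
      rw [← Set.ncard_pos]; omega
    have huw : G.Adj u w := hw
    set G' := G.deleteEdges {s(u, w)} with hG'
    have hle : G' ≤ G := SimpleGraph.deleteEdges_le _
    have hsub : ∀ x, G'.neighborSet x ⊆ G.neighborSet x := fun x y hy => hle hy
    have hdeg' : ∀ x, (G'.neighborSet x).ncard ≤ b + 1 := fun x =>
      (Set.ncard_le_ncard (hsub x)).trans (hdeg x)
    have hne' : (listColorings G' L).Nonempty := hne.mono (listColorings_anti hle L)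
    have hnu : G'.neighborSet u = G.neighborSet u \ {w} := by
      ext y
      simp only [SimpleGraph.mem_neighborSet, hG', SimpleGraph.deleteEdges_adj,
        Set.mem_singleton_iff, Set.mem_sdiff]
      refine and_congr_right fun hy => not_congr ⟨fun h => ?_, fun h => by rw [h]⟩
      rcases Sym2.eq_iff.1 h with ⟨_, h⟩ | ⟨h1, h2⟩
      · exact h
      · exact absurd h1 huw.ne
    have hnw : G'.neighborSet w ⊆ G.neighborSet w \ {u} := by
      intro y hy
      simp only [SimpleGraph.mem_neighborSet, hG', SimpleGraph.deleteEdges_adj,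
        Set.mem_singleton_iff, Set.mem_sdiff] at hy ⊢
      exact ⟨hy.1, fun h => hy.2 (by rw [h]; exact Sym2.eq_swap)⟩
    have hcu : (G'.neighborSet u).ncard = d := by
      rw [hnu, Set.ncard_sdiff_singleton_of_mem hw, hd]; rfl
    have hcw : (G'.neighborSet w).ncard ≤ b := by
      have h1 := Set.ncard_le_ncard hnw
      rw [Set.ncard_sdiff_singleton_of_mem (show u ∈ G.neighborSet w from huw.symm)] at h1
      have := hdeg w
      omega
    have hacyc : G'.IsAcyclic := hG.anti hle
    obtain ⟨f, hf, K, hK, hfK⟩ := ih G' hacyc hdeg' hcu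
      (fun x p hp => hL x (p.mapLe hle) (by simpa using hp)) hne'
    -- A walk from `w` becomes one from `u` on prefixing the edge `uw`; the extra unit of length is
    -- the round consumed.
    have hmsg := IH G' L w hacyc hdeg' hcw
      (fun x p hp => hL x (.cons huw (p.mapLe hle)) (by simpa using hp)) hne'
    refine ⟨Fin.cons (marginal G' L w) f, Fin.cases hmsg hf, K, hK, fun c => ?_⟩
    rw [card_filter_eq_of_isBridge (SimpleGraph.isAcyclic_iff_forall_adj_isBridge.1 hG huw) huw
      hne' c, hfK c, Fin.prod_univ_succ]
    simp only [Fin.cons_zero, Fin.cons_succ]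
    ring

theorem marginal_isMsg (n : ℕ) : ∀ (G : SimpleGraph V) (L : V → Set α) (u : V), G.IsAcyclic →
      (∀ x, (G.neighborSet x).ncard ≤ b + 1) → (G.neighborSet u).ncard ≤ b →
      (∀ x (p : G.Walk u x), p.length < n → L x = Set.univ) → (listColorings G L).Nonempty →
      IsMsg b n (marginal G L u) := by
  classical
  induction n with
  | zero =>
    intro G L u _ _ _ _ hne
    exact ⟨fun c => by unfold marginal; positivity, sum_marginal hne u⟩
  | succ n ih =>
    intro G L u hG hdeg hu hL hne
    obtain ⟨f, hf, K, hK, hfK⟩ := exists_msg_of_isAcyclic ih L u _ G hG hdeg rfl hL hne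
    refine ⟨_, hu, f, hf, K / (listColorings G L).card, by positivity, fun c => ?_,
      sum_marginal hne u⟩
    rw [marginal, hfK c, mul_div_right_comm]
end

/-! ### Balls in graphs of large girth are trees -/

namespace SimpleGraph
variable {V : Type*}

/-- The edges of `H` with both ends in `W`, as a graph on all nodes. -/
def restrictTo (H : SimpleGraph V) (W : Set V) : SimpleGraph V where
  Adj x y := H.Adj x y ∧ x ∈ W ∧ y ∈ W
  symm := ⟨fun _ _ h => ⟨h.1.symm, h.2.2, h.2.1⟩⟩
  loopless := ⟨fun _ h => h.1.ne rfl⟩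

/-- The nodes joined to `u` by a walk of length at most `n`. -/
def walkBall (H : SimpleGraph V) (u : V) (n : ℕ) : Set V := {x | ∃ p : H.Walk u x, p.length ≤ n}

theorem restrictTo_le (H : SimpleGraph V) (W : Set V) : H.restrictTo W ≤ H := fun _ _ h => h.1

/-- A walk joining the ends of an edge while avoiding it closes up to a cycle. -/
theorem egirth_le_of_walk {H : SimpleGraph V} {x z : V} (h : H.Adj x z) (p : H.Walk z x)
    (hp : s(x, z) ∉ p.edges) : H.egirth ≤ (p.length + 1 : ℕ) := by
  classical
  have hc : (Walk.cons h p.bypass).IsCycle :=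
    (Walk.cons_isCycle_iff _ h).2 ⟨p.bypass_isPath, fun h' => hp (p.edges_bypass_subset_edges h')⟩
  refine (egirth_le_length hc).trans ?_
  rw [Walk.length_cons]
  exact_mod_cast Nat.succ_le_succ p.length_bypass_le_length

/-- On a cycle inside the ball take the node `x` farthest from `u`. Some cycle neighbour `z` of `x`
is such that geodesics from `z` to `u` and from `u` to `x` avoid the edge `xz`; together they close
to a cycle of length at most `2n + 1`. -/
theorem isAcyclic_restrictTo_walkBall {H : SimpleGraph V} (u : V) {n : ℕ}
    (hg : ((2 * n + 2 : ℕ) : ℕ∞) ≤ H.egirth) : (H.restrictTo (H.walkBall u n)).IsAcyclic := by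
  classical
  set W := H.walkBall u n with hW
  intro v c₀ hc₀
  obtain ⟨x, hx, hmax⟩ := c₀.support.toFinset.exists_max_image (fun x => H.dist u x)
    ⟨v, by simp⟩
  rw [List.mem_toFinset] at hx
  have hc := hc₀.rotate hx
  set c := c₀.rotate x hx with hcdef
  have hmax' : ∀ y ∈ c.support, H.dist u y ≤ H.dist u x := fun y hy =>
    hmax y (List.mem_toFinset.2 ((Walk.mem_support_rotate_iff c₀ x hx).1 hy))
  have hnil : ¬ c.Nil := hc.not_nil
  have hy : (H.restrictTo W).Adj x c.snd := c.adj_snd hnil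
  have hy' : (H.restrictTo W).Adj x c.penultimate := (c.adj_penultimate hnil).symm
  have hball : ∀ z ∈ W, H.Reachable u z ∧ H.dist u z ≤ n := by
    rintro z ⟨p, hp⟩
    exact ⟨p.reachable, (dist_le p).trans hp⟩
  obtain ⟨hxr, hxn⟩ := hball x hy.2.1
  obtain ⟨q, hq⟩ := hxr.symm.exists_walk_length_eq_dist
  -- The geodesic `q` leaves `x` by at most one edge, whereas `x` has two distinct neighbours on the
  -- cycle.
  obtain ⟨z, hxz, hzc, hzq⟩ : ∃ z, (H.restrictTo W).Adj x z ∧ z ∈ c.support ∧ s(x, z) ∉ q.edges := by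
    have hqp : q.IsPath := q.isPath_of_length_eq_dist hq
    cases q with
    | nil => exact ⟨_, hy, c.getVert_mem_support 1, by simp⟩
    | @cons _ a _ h q' =>
      have hxq : x ∉ q'.support := ((Walk.cons_isPath_iff _ _).1 hqp).2
      have aux : ∀ z, z ≠ a → s(x, z) ∉ (Walk.cons h q').edges := by
        intro z hz hmem
        rw [Walk.edges_cons, List.mem_cons] at hmem
        rcases hmem with hmem | hmem
        · rcases Sym2.eq_iff.1 hmem with ⟨_, h'⟩ | ⟨h1, h2⟩
          · exact hz h'
          · exact h.ne h1
        · exact hxq (q'.fst_mem_support_of_mem_edges hmem)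
      by_cases h1 : c.snd = a
      · exact ⟨_, hy', c.getVert_mem_support _, aux _ fun h2 =>
          hc.snd_ne_penultimate (h1.trans h2.symm)⟩
      · exact ⟨_, hy, c.getVert_mem_support 1, aux _ h1⟩
  obtain ⟨hzr, hzn⟩ := hball z hxz.2.2
  obtain ⟨r, hr⟩ := hzr.symm.exists_walk_length_eq_dist
  -- Otherwise the geodesic from `z` would pass through `x`, making `z` strictly farther from `u`
  -- than `x`.
  have hzr : s(x, z) ∉ r.edges := by
    intro hmem
    have hxr := r.fst_mem_support_of_mem_edges hmem
    have h1 : H.dist x u ≤ (r.dropUntil x hxr).length := dist_le _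
    have h2 := congrArg Walk.length (r.take_spec hxr)
    rw [Walk.length_append] at h2
    have h3 : (r.takeUntil x hxr).length ≠ 0 := fun h0 =>
      hxz.ne (Walk.eq_of_length_eq_zero h0).symm
    have h4 := hmax' z hzc
    rw [dist_comm] at hr h1
    omega
  have h := egirth_le_of_walk hxz.1 (r.append q.reverse) (by
    rw [Walk.edges_append, List.mem_append, Walk.edges_reverse, List.mem_reverse]
    exact fun h => h.elim hzr hzq)
  have h' := hg.trans h
  rw [Nat.cast_le, Walk.length_append, Walk.length_reverse] at h'
  rw [dist_comm] at hr hq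
  omega

end SimpleGraph

/-! ### Pinning the boundary and deleting edges one at a time -/

theorem BoundedRatio.abs_sub_le {α : Type*} [Fintype α] {R : ℝ} {m : α → ℝ} (hm : BoundedRatio R m) (hR : 1 ≤ R) (c : α) :
    |m c - 1 / Fintype.card α| ≤ (R - 1) / Fintype.card α := by
  have hq : (0 : ℝ) < Fintype.card α := by
    exact_mod_cast Fintype.card_pos_iff.2 ⟨c⟩
  have h1 : Fintype.card α * m c ≤ R := by
    have := Finset.sum_le_sum fun c' (_ : c' ∈ Finset.univ) => hm.ratio c c'
    rw [← Finset.mul_sum, hm.sum_eq, mul_one] at this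
    simpa using this
  have h2 : 1 ≤ R * (Fintype.card α * m c) := by
    have := Finset.sum_le_sum fun c' (_ : c' ∈ Finset.univ) => hm.ratio c' c
    rw [hm.sum_eq] at this
    simp at this
    linarith
  have e : m c - 1 / Fintype.card α = (Fintype.card α * m c - 1) / Fintype.card α := by
    field_simp
  rw [e, abs_div, abs_of_pos hq]
  gcongr
  rw [abs_le]
  constructor <;> nlinarith

theorem abs_log_sub_log_le {x y : ℝ} (hx : 1 / 2 ≤ x) (hy : 1 / 2 ≤ y) :
    |Real.log x - Real.log y| ≤ 2 * |x - y| := by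
  have aux : ∀ {x y : ℝ}, 1 / 2 ≤ x → 1 / 2 ≤ y → Real.log x - Real.log y ≤ 2 * |x - y| := by
    intro x y hx hy
    have hx0 : 0 < x := by linarith
    have hy0 : 0 < y := by linarith
    have h := Real.log_le_sub_one_of_pos (div_pos hx0 hy0)
    rw [Real.log_div hx0.ne' hy0.ne'] at h
    have e : x / y - 1 = (x - y) / y := by field_simp
    have h2 : (x - y) / y ≤ 2 * |x - y| := by
      rw [div_le_iff₀ hy0]
      nlinarith [le_abs_self (x - y), abs_nonneg (x - y)]
    linarith
  rw [abs_le]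
  have := aux hy hx
  rw [abs_sub_comm] at this
  exact ⟨by linarith, aux hx hy⟩

section
variable {V α : Type*}

/-- The lists left to the nodes of `W` when the nodes outside `W` are coloured by `σ₀`. -/
def pinnedLists (H : SimpleGraph V) (W : Set V) (σ₀ : V → α) (x : V) : Set α :=
  {c | (x ∈ W ∧ ∀ y ∉ W, H.Adj x y → c ≠ σ₀ y) ∨ (x ∉ W ∧ c = σ₀ x)}

theorem pinnedLists_eq_univ {H : SimpleGraph V} {u : V} {n : ℕ} (σ₀ : V → α) {x : V}
    (p : H.Walk u x) (hp : p.length < n) : pinnedLists H (H.walkBall u n) σ₀ x = Set.univ := by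
  refine Set.eq_univ_of_forall fun c => Or.inl ⟨⟨p, hp.le⟩, fun y hy hxy => ?_⟩
  exact absurd ⟨p.concat hxy, by rw [SimpleGraph.Walk.length_concat]; exact hp⟩ hy

variable [Fintype V] [Fintype α]

/-- Conditioning on the colours outside `W` becomes a list-colouring problem on the edges inside
`W`, to which the tree recursion applies. -/
theorem mem_listColorings_pinnedLists {H : SimpleGraph V} {W : Set V} {σ₀ : V → α}
    (hσ₀ : σ₀ ∈ listColorings H fun _ => Set.univ) (σ : V → α) :
    σ ∈ listColorings (H.restrictTo W) (pinnedLists H W σ₀) ↔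
      σ ∈ listColorings H (fun _ => Set.univ) ∧ ∀ x ∉ W, σ x = σ₀ x := by
  simp only [mem_listColorings, Set.mem_univ, implies_true, and_true] at hσ₀ ⊢
  constructor
  · rintro ⟨h, hL⟩
    have hout : ∀ x ∉ W, σ x = σ₀ x := fun x hx => by
      rcases hL x with h' | h'
      · exact absurd h'.1 hx
      · exact h'.2
    have hin : ∀ x ∈ W, ∀ y ∉ W, H.Adj x y → σ x ≠ σ₀ y := fun x hx => by
      rcases hL x with h' | h'
      · exact h'.2
      · exact absurd hx h'.1
    refine ⟨fun x y hxy => ?_, hout⟩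
    by_cases hx : x ∈ W <;> by_cases hy : y ∈ W
    · exact h x y ⟨hxy, hx, hy⟩
    · rw [hout y hy]; exact hin x hx y hy hxy
    · rw [hout x hx]; exact (hin y hy x hx hxy.symm).symm
    · rw [hout x hx, hout y hy]; exact hσ₀ x y hxy
  · rintro ⟨h, hout⟩
    refine ⟨fun x y hxy => h x y hxy.1, fun x => ?_⟩
    by_cases hx : x ∈ W
    · exact Or.inl ⟨hx, fun y hy hxy => hout y hy ▸ h x y hxy⟩
    · exact Or.inr ⟨hx, hout x hx⟩

variable {b : ℕ}

open Classical in
/-- In a graph of large girth the colours of two distant nodes agree with probability about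
`1 / q`. -/
theorem abs_card_filter_eq_sub_le (hα : Fintype.card α = b + 2) {R : ℝ} (hR : 1 ≤ R) {n : ℕ}
    (hmsg : ∀ m : α → ℝ, IsMsg b n m → BoundedRatio R m) {H : SimpleGraph V} {u v : V}
    (hg : ((2 * n + 2 : ℕ) : ℕ∞) ≤ H.egirth) (hdeg : ∀ x, (H.neighborSet x).ncard ≤ b + 1)
    (hu : (H.neighborSet u).ncard ≤ b) (hv : v ∉ H.walkBall u n) :
    |(((listColorings H fun _ => (Set.univ : Set α)).filter fun σ => σ u = σ v).card : ℝ)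
        - 1 / (b + 2) * (listColorings H fun _ => (Set.univ : Set α)).card|
      ≤ (R - 1) / (b + 2) * (listColorings H fun _ => (Set.univ : Set α)).card ∧
    (((listColorings H fun _ => (Set.univ : Set α)).filter fun σ => σ u = σ v).card : ℝ)
      ≤ 1 / 2 * (listColorings H fun _ => (Set.univ : Set α)).card := by
  set W := H.walkBall u n with hW
  set S := listColorings H fun _ => (Set.univ : Set α) with hS
  set r : (V → α) → ({x // x ∉ W} → α) := fun σ x => σ x with hr
  -- Condition on the colouring `η` outside the ball. It fixes the colour of `v`, so the event
  -- concerns a single entry of the message at `u`; the estimates are then summed over `η`.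
  have hfib : ∀ η, |(((S.filter fun σ => σ u = σ v).filter fun σ => r σ = η).card : ℝ)
        - 1 / (b + 2) * (S.filter fun σ => r σ = η).card|
        ≤ (R - 1) / (b + 2) * (S.filter fun σ => r σ = η).card ∧
      (((S.filter fun σ => σ u = σ v).filter fun σ => r σ = η).card : ℝ)
        ≤ 1 / 2 * (S.filter fun σ => r σ = η).card := by
    intro η
    rcases (S.filter fun σ => r σ = η).eq_empty_or_nonempty with hem | ⟨σ₀, hσ₀⟩
    · have : (S.filter fun σ => σ u = σ v).filter (fun σ => r σ = η) = ∅ := by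
        rw [Finset.filter_comm, hem, Finset.filter_empty]
      rw [this, hem]
      simp
    rw [Finset.mem_filter] at hσ₀
    obtain ⟨hσ₀S, rfl⟩ := hσ₀
    set G := H.restrictTo W with hG
    set L := pinnedLists H W σ₀ with hL
    have hle : G ≤ H := H.restrictTo_le W
    have e1 : S.filter (fun σ => r σ = r σ₀) = listColorings G L := by
      ext σ
      rw [mem_listColorings_pinnedLists hσ₀S, Finset.mem_filter]
      refine and_congr_right fun _ => ?_
      rw [funext_iff]
      exact ⟨fun h x hx => h ⟨x, hx⟩, fun h x => h x x.2⟩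
    have e2 : (S.filter fun σ => σ u = σ v).filter (fun σ => r σ = r σ₀)
        = (listColorings G L).filter fun σ => σ u = σ₀ v := by
      rw [Finset.filter_comm, e1]
      refine Finset.filter_congr fun σ hσ => ?_
      rw [((mem_listColorings_pinnedLists hσ₀S σ).1 hσ).2 v hv]
    have hne : (listColorings G L).Nonempty :=
      ⟨σ₀, e1 ▸ Finset.mem_filter.2 ⟨hσ₀S, rfl⟩⟩
    have hsub : ∀ x, (G.neighborSet x).ncard ≤ (H.neighborSet x).ncard := fun x =>
      Set.ncard_le_ncard fun y hy => hle hy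
    have hm := hmsg _ (marginal_isMsg n G L u (SimpleGraph.isAcyclic_restrictTo_walkBall u hg)
      (fun x => (hsub x).trans (hdeg x)) ((hsub u).trans hu)
      (fun x p hp => pinnedLists_eq_univ σ₀ (p.mapLe hle) (by simpa using hp)) hne)
    have hZ : (0 : ℝ) < (listColorings G L).card := by exact_mod_cast hne.card_pos
    have e3 : (((listColorings G L).filter fun σ => σ u = σ₀ v).card : ℝ)
        = marginal G L u (σ₀ v) * (listColorings G L).card := by
      rw [marginal, div_mul_cancel₀ _ hZ.ne']
    rw [e2, e1, e3, ← sub_mul, abs_mul, abs_of_pos hZ]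
    have h := hm.abs_sub_le hR (σ₀ v)
    rw [hα] at h
    push_cast at h
    exact ⟨by gcongr, mul_le_mul_of_nonneg_right (hm.le_half _) hZ.le⟩
  have s1 : ((S.filter fun σ => σ u = σ v).card : ℝ)
      = ∑ η, (((S.filter fun σ => σ u = σ v).filter fun σ => r σ = η).card : ℝ) := by
    exact_mod_cast Finset.card_eq_sum_card_fiberwise (f := r) (t := Finset.univ)
      fun _ _ => Finset.mem_coe.2 (Finset.mem_univ _)
  have s2 : (S.card : ℝ) = ∑ η, ((S.filter fun σ => r σ = η).card : ℝ) := by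
    exact_mod_cast Finset.card_eq_sum_card_fiberwise (f := r) (t := Finset.univ)
      fun _ _ => Finset.mem_coe.2 (Finset.mem_univ _)
  rw [s1, s2, Finset.mul_sum, Finset.mul_sum, Finset.mul_sum, ← Finset.sum_sub_distrib]
  exact ⟨(Finset.abs_sum_le_sum_abs _ _).trans (Finset.sum_le_sum fun η _ => (hfib η).1),
    Finset.sum_le_sum fun η _ => (hfib η).2⟩

/-- The Bethe approximation to the number of colourings of a graph of large girth. -/
theorem abs_log_card_listColorings_sub_le (hα : Fintype.card α = b + 2) {R : ℝ} (hR : 1 ≤ R)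
    {n : ℕ} (hmsg : ∀ m : α → ℝ, IsMsg b n m → BoundedRatio R m) (k : ℕ) :
    ∀ G : SimpleGraph V, G.edgeSet.ncard = k → ((2 * n + 2 : ℕ) : ℕ∞) ≤ G.egirth →
      (∀ x, (G.neighborSet x).ncard ≤ b + 1) →
      (listColorings G fun _ => (Set.univ : Set α)).Nonempty ∧
      |Real.log (listColorings G fun _ => (Set.univ : Set α)).card
        - (Fintype.card V * Real.log (b + 2) + k * Real.log (1 - 1 / (b + 2)))|
        ≤ k * (2 * ((R - 1) / (b + 2))) := by
  classical
  induction k with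
  | zero =>
    intro G hk _ _
    rw [Set.ncard_eq_zero, SimpleGraph.edgeSet_eq_empty] at hk
    subst hk
    have : listColorings (⊥ : SimpleGraph V) (fun _ => (Set.univ : Set α)) = Finset.univ := by
      ext σ; simp [mem_listColorings]
    have hne : Nonempty α := Fintype.card_pos_iff.1 (by omega)
    rw [this]
    refine ⟨Finset.univ_nonempty, ?_⟩
    simp [hα]
  | succ k ih =>
    intro G hk hg hdeg
    obtain ⟨e, he⟩ : G.edgeSet.Nonempty := by
      rw [← Set.ncard_pos]; omega
    induction e using Sym2.ind with
    | _ u v =>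
    have huv : G.Adj u v := he
    set H := G.deleteEdges {s(u, v)} with hH
    have hle : H ≤ G := SimpleGraph.deleteEdges_le _
    have hsub : ∀ x, H.neighborSet x ⊆ G.neighborSet x := fun x y hy => hle hy
    have hgH : ((2 * n + 2 : ℕ) : ℕ∞) ≤ H.egirth := hg.trans (SimpleGraph.egirth_anti hle)
    have hdegH : ∀ x, (H.neighborSet x).ncard ≤ b + 1 := fun x =>
      (Set.ncard_le_ncard (hsub x)).trans (hdeg x)
    have hkH : H.edgeSet.ncard = k := by
      rw [hH, SimpleGraph.edgeSet_deleteEdges, Set.ncard_sdiff_singleton_of_mem he, hk]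
      rfl
    have hu : (H.neighborSet u).ncard ≤ b := by
      have h1 : H.neighborSet u ⊆ G.neighborSet u \ {v} := by
        intro y hy
        simp only [SimpleGraph.mem_neighborSet, hH, SimpleGraph.deleteEdges_adj,
          Set.mem_singleton_iff, Set.mem_sdiff] at hy ⊢
        exact ⟨hy.1, fun h => hy.2 (by rw [h])⟩
      have h2 := Set.ncard_le_ncard h1
      rw [Set.ncard_sdiff_singleton_of_mem (show v ∈ G.neighborSet u from huv)] at h2
      have := hdeg u
      omega
    -- A walk of length at most `n` from `u` to `v` in `H` would close with the deleted edge to a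
    -- cycle of length at most `n + 1`.
    have hv : v ∉ H.walkBall u n := by
      rintro ⟨p, hp⟩
      have h := SimpleGraph.egirth_le_of_walk huv.symm (p.mapLe hle) (by
        intro hmem
        have : s(v, u) ∈ H.edgeSet := p.edges_subset_edgeSet (by simpa using hmem)
        rw [hH, SimpleGraph.edgeSet_deleteEdges, Sym2.eq_swap] at this
        exact this.2 rfl)
      have h' := hg.trans h
      rw [Nat.cast_le] at h'
      simp at h'
      omega
    obtain ⟨hne, hlog⟩ := ih H hkH hgH hdegH
    obtain ⟨h1, h2⟩ := abs_card_filter_eq_sub_le hα hR hmsg hgH hdegH hu hv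
    have e1 : listColorings G (fun _ => (Set.univ : Set α))
        = (listColorings H fun _ => (Set.univ : Set α)).filter fun σ => ¬ σ u = σ v := by
      ext σ
      simp only [Finset.mem_filter, mem_listColorings, hH, SimpleGraph.deleteEdges_adj,
        Set.mem_singleton_iff, Set.mem_univ, implies_true, and_true]
      constructor
      · exact fun h => ⟨fun x y hxy => h x y hxy.1, h u v huv⟩
      · rintro ⟨h, hc⟩ x y hxy
        by_cases he : s(x, y) = s(u, v)
        · rcases Sym2.eq_iff.1 he with ⟨rfl, rfl⟩ | ⟨rfl, rfl⟩
          · exact hc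
          · exact fun h' => hc h'.symm
        · exact h x y ⟨hxy, he⟩
    have h3 := congrArg (Nat.cast (R := ℝ)) (Finset.card_filter_add_card_filter_not
      (s := listColorings H fun _ => (Set.univ : Set α)) (fun σ => σ u = σ v))
    rw [← e1] at h3
    push_cast at h3
    have hZ : (0 : ℝ) < (listColorings H fun _ => (Set.univ : Set α)).card := by
      exact_mod_cast hne.card_pos
    set Z : ℝ := ((listColorings H fun _ => (Set.univ : Set α)).card : ℝ) with hZdef
    set N : ℝ := (((listColorings H fun _ => (Set.univ : Set α)).filter
      fun σ => σ u = σ v).card : ℝ) with hN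
    have hZG : ((listColorings G fun _ => (Set.univ : Set α)).card : ℝ) = Z * (1 - N / Z) := by
      rw [mul_sub, mul_one, mul_div_cancel₀ _ hZ.ne']; linarith
    -- This bound keeps `G` colourable, and also places the logarithm where it is `2`-Lipschitz.
    have hp1 : 1 / 2 ≤ 1 - N / Z := by
      have : N / Z ≤ 1 / 2 := by rwa [div_le_iff₀ hZ]
      linarith
    have hb : (0 : ℝ) ≤ b := b.cast_nonneg
    have hp2 : (1 : ℝ) / 2 ≤ 1 - 1 / (b + 2) := by
      have : (1 : ℝ) / (b + 2) ≤ 1 / 2 := by gcongr; linarith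
      linarith
    have hp3 : |1 - N / Z - (1 - 1 / (b + 2))| ≤ (R - 1) / (b + 2) := by
      have e : 1 - N / Z - (1 - 1 / (b + 2)) = -(N - 1 / (b + 2) * Z) / Z := by
        field_simp; ring
      rw [e, abs_div, abs_neg, abs_of_pos hZ, div_le_iff₀ hZ]
      exact h1
    have hGpos : (0 : ℝ) < (listColorings G fun _ => (Set.univ : Set α)).card := by
      rw [hZG]; exact mul_pos hZ (by linarith)
    refine ⟨Finset.card_pos.1 (by exact_mod_cast hGpos), ?_⟩
    rw [hZG, Real.log_mul hZ.ne' (by linarith)]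
    have h4 := (abs_log_sub_log_le hp1 hp2).trans (mul_le_mul_of_nonneg_left hp3 zero_le_two)
    push_cast
    rw [abs_le] at h4 hlog ⊢
    constructor <;> linarith [h4.1, h4.2, hlog.1, hlog.2]
end

/-! ### Regular graphs and the limit -/

theorem numColorings_eq_card {n q : ℕ} (G : SimpleGraph (Fin n)) :
    numColorings q G = (listColorings G fun _ => (Set.univ : Set (Fin q))).card := by
  rw [numColorings, ← Fintype.card_coe, ← Nat.card_eq_fintype_card]
  exact Nat.card_congr
    { toFun := fun C => ⟨C, mem_listColorings.2 ⟨fun _ _ h => C.valid h, fun _ => trivial⟩⟩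
      invFun := fun σ => .mk σ.1 fun h => (mem_listColorings.1 σ.2).1 _ _ h
      left_inv := fun _ => rfl
      right_inv := fun _ => rfl }

theorem ncard_neighborSet_of_mem {n g r : ℕ} {G : SimpleGraph (Fin n)}
    (hG : G ∈ regularGraphs n g r) (x : Fin n) : (G.neighborSet x).ncard = r := by
  classical
  have h := hG.1 x
  rw [← SimpleGraph.card_neighborSet_eq_degree, ← Nat.card_eq_fintype_card] at h
  rw [← h, Nat.card_coe_set_eq]

theorem two_mul_ncard_edgeSet_of_mem {n g r : ℕ} {G : SimpleGraph (Fin n)}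
    (hG : G ∈ regularGraphs n g r) : 2 * G.edgeSet.ncard = n * r := by
  classical
  have h := G.sum_degrees_eq_twice_card_edges
  have hdeg : ∀ x, G.degree x = r := fun x => by
    rw [← ncard_neighborSet_of_mem hG x, ← SimpleGraph.card_neighborSet_eq_degree,
      ← Nat.card_eq_fintype_card, Nat.card_coe_set_eq]
  simp only [hdeg, Finset.sum_const, Finset.card_univ, Fintype.card_fin, smul_eq_mul] at h
  rw [h, Set.ncard_eq_toFinset_card', SimpleGraph.edgeFinset]

theorem log_bethe {b r : ℕ} : Real.log (((b + 2 : ℕ) : ℝ) * (1 - 1 / ((b + 2 : ℕ) : ℝ)) ^ ((r : ℝ) / 2))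
    = Real.log (b + 2) + r / 2 * Real.log (1 - 1 / (b + 2)) := by
  have hb : (0 : ℝ) ≤ b := b.cast_nonneg
  have h : (0 : ℝ) < 1 - 1 / (b + 2) := by
    rw [sub_pos, div_lt_one (by positivity)]; linarith
  push_cast
  rw [Real.log_mul (by positivity) (Real.rpow_pos_of_pos h _).ne', Real.log_rpow h]

theorem theorem4 (r q : ℕ) (hq : r + 1 ≤ q) :
    Tendsto
      (fun g : ℕ => ⨆ (n : ℕ) (_ : 0 < n) (G ∈ regularGraphs n g r),
        ENNReal.ofReal
          |Real.log (numColorings q G : ℝ) / (n : ℝ)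
            - Real.log ((q : ℝ) * (1 - 1 / (q : ℝ)) ^ ((r : ℝ) / 2))|)
      atTop (𝓝 (0 : ℝ≥0∞)) := by
  obtain ⟨B, hB0, hB⟩ : ∃ B : ℕ → ℝ, Tendsto B atTop (𝓝 0) ∧ ∀ᶠ g in atTop, ∀ n : ℕ, 0 < n →
      ∀ G ∈ regularGraphs n g r, |Real.log (numColorings q G : ℝ) / (n : ℝ)
            - Real.log ((q : ℝ) * (1 - 1 / (q : ℝ)) ^ ((r : ℝ) / 2))| ≤ B g := by
    rcases Nat.lt_or_ge q 2 with h2 | h2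
    · obtain rfl : q = 1 := by omega
      obtain rfl : r = 0 := by omega
      refine ⟨fun _ => 0, tendsto_const_nhds, .of_forall fun g n hn G hG => ?_⟩
      have hadj : ∀ x y, ¬ G.Adj x y := fun x y hxy => by
        have h := ncard_neighborSet_of_mem hG x
        rw [Set.ncard_eq_zero] at h
        have : y ∈ G.neighborSet x := hxy
        simp [h] at this
      have h1 : listColorings G (fun _ => (Set.univ : Set (Fin 1))) = Finset.univ :=
        Finset.eq_univ_iff_forall.2 fun σ =>
          mem_listColorings.2 ⟨fun x y h => absurd h (hadj x y), fun _ => trivial⟩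
      rw [numColorings_eq_card, h1]
      simp
    · obtain ⟨b, rfl⟩ := Nat.exists_eq_add_of_le' h2
      obtain ⟨R, hR1, hR, hmsg⟩ := exists_ratio_bound (α := Fin (b + 2)) (b := b) (by simp)
      -- With `k = (g - 6) / 2`, `R k` controls messages of `k + 2` rounds, which need girth `2 (k +
      -- 2) + 2 ≤ g`; this holds once `g ≥ 6`. The factor `r` is `r / 2` edges per node times the
      -- error `2 (R k - 1) / q` per edge.
      refine ⟨fun g => r * ((R ((g - 6) / 2) - 1) / (b + 2)), ?_, ?_⟩
      · have hk : Tendsto (fun g : ℕ => (g - 6) / 2) atTop atTop :=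
          (Nat.tendsto_div_const_atTop (by norm_num)).comp (tendsto_sub_atTop_nat 6)
        have h := (((hR1.comp hk).sub_const 1).div_const ((b : ℝ) + 2)).const_mul (r : ℝ)
        simpa using h
      · filter_upwards [eventually_ge_atTop 6] with g hg n hn G hG
        have hn' : (0 : ℝ) < n := by exact_mod_cast hn
        set k := (g - 6) / 2 with hk
        have hgirth : ((2 * (k + 2) + 2 : ℕ) : ℕ∞) ≤ G.egirth :=
          le_trans (by exact_mod_cast (by omega)) hG.2
        obtain ⟨-, h⟩ := abs_log_card_listColorings_sub_le (b := b) (by simp) (hR k) (hmsg k) _ G rfl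
          hgirth fun x => by rw [ncard_neighborSet_of_mem hG x]; omega
        have hE : (G.edgeSet.ncard : ℝ) = n * (r / 2) := by
          have : (2 : ℝ) * G.edgeSet.ncard = n * r := by
            exact_mod_cast two_mul_ncard_edgeSet_of_mem hG
          linarith
        rw [log_bethe, numColorings_eq_card]
        rw [hE, Fintype.card_fin] at h
        have e : ∀ z : ℝ, z / n - (Real.log (b + 2) + r / 2 * Real.log (1 - 1 / (b + 2)))
            = (z - (n * Real.log (b + 2) + n * (r / 2) * Real.log (1 - 1 / (b + 2)))) / n := by
          intro z; field_simp
        rw [e, abs_div, abs_of_pos hn', div_le_iff₀ hn']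
        refine h.trans_eq ?_
        ring
  have hlim : Tendsto (fun g => ENNReal.ofReal (B g)) atTop (𝓝 0) := by
    simpa using ENNReal.tendsto_ofReal hB0
  refine tendsto_of_tendsto_of_tendsto_of_le_of_le' tendsto_const_nhds hlim
    (.of_forall fun _ => zero_le) ?_
  filter_upwards [hB] with g hg
  exact iSup_le fun n => iSup_le fun hn => iSup_le fun G => iSup_le fun hG =>
    ENNReal.ofReal_le_ofReal (hg n hn G hG)
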